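/- Let $\mathbb{CP}^2$ be the complex projective plane, regarded as a smooth manifold of real dimension $4$, with the Fubini–Study form $\omega$ normalized by $\pi^*\omega=\iota^*\Omega_0$. Here $\pi:S^5\to\mathbb{CP}^2$ is the Hopf projection, $\iota:S^5\hookrightarrow\mathbb{C}^3$ is the inclusion of the unit sphere, and $\Omega_0=\frac{i}{2}\sum_{k=0}^{2}du_k\wedge d\bar u_k$ is the standard symplectic form. (With this normalization the total volume of $\mathbb{CP}^2$ is $\pi^2/2$.) Let $$\mathcal{L}_2=\left\{\left[\bar\alpha^2+\bar\beta^2:\sqrt2\,(\bar\alpha\beta-\alpha\bar\beta):\alpha^2+\beta^2\right]\;\middle|\;\alpha,\beta\in\mathbb{C},\ |\alpha|^2+|\beta|^2=1\right\}\subset\mathbb{CP}^2 .$$ Then $\mathcal{L}_2$ is a Lagrangian submanifold of $(\mathbb{CP}^2,\omega)$: it is a smooth embedded submanifold of real dimension $2=\frac12\dim_{\mathbb{R}}\mathbb{CP}^2$, and $\omega_p(u,v)=0$ for all $p\in\mathcal{L}_2$ and all $u,v\in T_p\mathcal{L}_2$. -/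

import Mathlib

open scoped Manifold ContDiff LinearAlgebra.Projectivization Topology
open Set

/-! ### Complex projective space as a smooth manifold -/

/-- Complex projective space `ℂℙⁿ`, the set of complex lines in `ℂⁿ⁺¹`. -/
abbrev CP (n : ℕ) : Type := ℙ ℂ (Fin (n + 1) → ℂ)

namespace CP

variable {n : ℕ}

/-- The quotient topology coming from `ℂⁿ⁺¹ ∖ {0}`. -/
noncomputable instance instTopologicalSpace : TopologicalSpace (CP n) :=
  TopologicalSpace.coinduced (Projectivization.mk' ℂ (V := Fin (n + 1) → ℂ)) inferInstance

/-- The point `[z₀ : ⋯ : zₙ]` with homogeneous coordinates `z`. -/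
noncomputable def pt (z : {z : Fin (n + 1) → ℂ // z ≠ 0}) : CP n := Projectivization.mk ℂ z.1 z.2

lemma isQuotientMap_pt : Topology.IsQuotientMap (pt (n := n)) where
  surjective := fun p => ⟨⟨p.rep, p.rep_nonzero⟩, p.mk_rep⟩
  eq_coinduced := rfl

lemma exists_rep_mk (v : Fin (n + 1) → ℂ) (hv : v ≠ 0) :
    ∃ a : ℂ, a ≠ 0 ∧ ∀ j, (Projectivization.mk ℂ v hv).rep j = a * v j := by
  obtain ⟨a, ha⟩ := Projectivization.exists_smul_eq_mk_rep ℂ v hv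
  refine ⟨a, a.ne_zero, fun j => ?_⟩
  rw [← ha]; rfl

lemma rep_mk_ne_zero_iff (v : Fin (n + 1) → ℂ) (hv : v ≠ 0) (i : Fin (n + 1)) :
    (Projectivization.mk ℂ v hv).rep i ≠ 0 ↔ v i ≠ 0 := by
  obtain ⟨a, ha, h⟩ := exists_rep_mk v hv
  simp [h, ha]

/-- Inhomogeneous coordinates `(z_j / z_i)_{j ≠ i}`. -/
noncomputable def affineCoord (i : Fin (n + 1)) (p : CP n) : Fin n → ℂ :=
  fun j => p.rep (i.succAbove j) / p.rep i

lemma affineCoord_mk (i : Fin (n + 1)) (v : Fin (n + 1) → ℂ) (hv : v ≠ 0) :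
    affineCoord i (Projectivization.mk ℂ v hv) = fun j => v (i.succAbove j) / v i := by
  obtain ⟨a, ha, h⟩ := exists_rep_mk v hv
  funext j
  simp only [affineCoord, h]
  exact mul_div_mul_left _ _ ha

/-- `insertAt i c w` is the vector of `ℂⁿ⁺¹` with `i`-th entry `c` and the other entries,
in order, those of `w`. -/
def insertAt (i : Fin (n + 1)) (c : ℂ) (w : Fin n → ℂ) : Fin (n + 1) → ℂ :=
  Fin.insertNth (α := fun _ => ℂ) i c w

@[simp] lemma insertAt_same (i : Fin (n + 1)) (c : ℂ) (w : Fin n → ℂ) :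
    insertAt i c w i = c := by simp [insertAt]

@[simp] lemma insertAt_succAbove (i : Fin (n + 1)) (c : ℂ) (w : Fin n → ℂ) (j : Fin n) :
    insertAt i c w (i.succAbove j) = w j := by simp [insertAt]

lemma insertAt_one_ne_zero (i : Fin (n + 1)) (w : Fin n → ℂ) : insertAt i 1 w ≠ 0 := fun h => by
  simpa using congrFun h i

lemma contDiff_insertAt (i : Fin (n + 1)) (c : ℂ) : ContDiff ℝ ∞ (insertAt (n := n) i c) := by
  rw [contDiff_pi]
  intro k
  rcases Fin.eq_self_or_eq_succAbove i k with rfl | ⟨j, rfl⟩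
  · simpa using contDiff_const
  · simpa using contDiff_apply ℝ ℂ j

/-- The point with `z_i = 1` and inhomogeneous coordinates `w`. -/
noncomputable def affinePoint (i : Fin (n + 1)) (w : Fin n → ℂ) : CP n :=
  pt ⟨insertAt i 1 w, insertAt_one_ne_zero i w⟩

/-- The `i`-th affine chart of `ℂℙⁿ`, with domain `{z_i ≠ 0}`. -/
noncomputable def affineChart (i : Fin (n + 1)) : OpenPartialHomeomorph (CP n) (Fin n → ℂ) where
  toFun := affineCoord i
  invFun := affinePoint i
  source := {p | p.rep i ≠ 0}
  target := univ
  map_source' _ _ := mem_univ _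
  map_target' w _ := (rep_mk_ne_zero_iff _ _ i).2 (by simp)
  left_inv' p hp := by
    have hp : p.rep i ≠ 0 := hp
    conv_rhs => rw [← p.mk_rep]
    refine (Projectivization.mk_eq_mk_iff' ℂ _ _ _ _).2 ⟨(p.rep i)⁻¹, ?_⟩
    funext k
    rcases Fin.eq_self_or_eq_succAbove i k with rfl | ⟨j, rfl⟩
    · simp [hp]
    · simp [affineCoord, div_eq_inv_mul]
  right_inv' w _ := by
    simp [affinePoint, pt, affineCoord_mk]
  open_source := by
    rw [← isQuotientMap_pt.isOpen_preimage]
    have : pt ⁻¹' {p : CP n | p.rep i ≠ 0} = {z | z.1 i ≠ 0} := by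
      ext z
      exact rep_mk_ne_zero_iff _ _ i
    rw [this]
    exact isOpen_ne_fun ((continuous_apply i).comp continuous_subtype_val) continuous_const
  open_target := isOpen_univ
  continuousOn_toFun := by
    have hs : IsOpen {p : CP n | p.rep i ≠ 0} := by
      rw [← isQuotientMap_pt.isOpen_preimage]
      have : pt ⁻¹' {p : CP n | p.rep i ≠ 0} = {z | z.1 i ≠ 0} := by
        ext z
        exact rep_mk_ne_zero_iff _ _ i
      rw [this]
      exact isOpen_ne_fun ((continuous_apply i).comp continuous_subtype_val) continuous_const
    change ContinuousOn (affineCoord i) _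
    rw [isQuotientMap_pt.continuousOn_isOpen_iff hs]
    refine continuousOn_pi.2 fun j => ?_
    have : ∀ z : {z : Fin (n + 1) → ℂ // z ≠ 0},
        (affineCoord i ∘ pt) z j = z.1 (i.succAbove j) / z.1 i := fun z => by
      simp [pt, affineCoord_mk]
    simp only [this]
    refine ContinuousOn.div ((continuous_apply _).comp continuous_subtype_val).continuousOn
      ((continuous_apply _).comp continuous_subtype_val).continuousOn fun z hz => ?_
    exact (rep_mk_ne_zero_iff _ _ i).1 hz
  continuousOn_invFun := by
    refine Continuous.continuousOn (isQuotientMap_pt.continuous.comp ?_)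
    exact (contDiff_insertAt i 1).continuous.subtype_mk _

lemma exists_rep_ne_zero (p : CP n) : ∃ i, p.rep i ≠ 0 :=
  Function.ne_iff.1 p.rep_nonzero

/-- An index `i` with `z_i ≠ 0`, used to select the preferred affine chart at `p`. -/
noncomputable def chartIndex (p : CP n) : Fin (n + 1) := (exists_rep_ne_zero p).choose

lemma rep_chartIndex_ne_zero (p : CP n) : p.rep (chartIndex p) ≠ 0 :=
  (exists_rep_ne_zero p).choose_spec

noncomputable instance instChartedSpace : ChartedSpace (Fin n → ℂ) (CP n) where
  atlas := range affineChart
  chartAt p := affineChart (chartIndex p)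
  mem_chart_source p := rep_chartIndex_ne_zero p
  chart_mem_atlas _ := mem_range_self _

/-- `ℂℙⁿ` is a smooth real manifold, modelled on the real vector space underlying `ℂⁿ`. -/
instance instIsManifold : IsManifold 𝓘(ℝ, Fin n → ℂ) ∞ (CP n) := by
  refine isManifold_of_contDiffOn _ _ _ ?_
  rintro _ _ ⟨i, rfl⟩ ⟨i', rfl⟩
  have key : ∀ w : Fin n → ℂ, affineCoord i' (affinePoint i w) =
      fun j => insertAt i 1 w (i'.succAbove j) / insertAt i 1 w i' :=
    fun w => affineCoord_mk _ _ _
  have h1 : ContDiffOn ℝ ∞ (fun w : Fin n → ℂ =>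
      fun j => insertAt i 1 w (i'.succAbove j) / insertAt i 1 w i')
      {w | insertAt i 1 w i' ≠ 0} := by
    refine contDiffOn_pi.2 fun j => ?_
    simp only [div_eq_mul_inv]
    exact ContDiffOn.mul ((contDiff_pi.1 (contDiff_insertAt i 1) _).contDiffOn)
      (ContDiffOn.inv ((contDiff_pi.1 (contDiff_insertAt i 1) _).contDiffOn) fun w hw => hw)
  refine (h1.mono ?_).congr fun w _ => key w
  intro w hw
  have : (affinePoint i w).rep i' ≠ 0 := by
    exact hw.1.2
  exact (rep_mk_ne_zero_iff _ _ i').1 this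

/-! ### The Fubini-Study form -/

/-- The standard symplectic form `(i/2) ∑ duₖ ∧ dūₖ` on `ℂᵐ`, i.e. the imaginary part of the
standard hermitian product `h(a, b) = āᵀ b`. -/
noncomputable def stdSymplectic {m : ℕ} (a b : Fin m → ℂ) : ℝ := (star a ⬝ᵥ b).im

/-- The form `(i/2) ∂∂̄ log |z|²` on `ℂⁿ⁺¹ ∖ {0}`, at the point `z`:
`(|z|² Im h(a, b) - Im (h(a, z) h(z, b))) / |z|⁴`. -/
noncomputable def homogeneousForm {m : ℕ} (z a b : Fin m → ℂ) : ℝ :=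
  ((star z ⬝ᵥ z).re * stdSymplectic a b - ((star a ⬝ᵥ z) * (star z ⬝ᵥ b)).im)
    / (star z ⬝ᵥ z).re ^ 2

section Bilinear

variable {m : ℕ} (z a a' b b' : Fin m → ℂ) (c : ℝ)

lemma homogeneousForm_add_left :
    homogeneousForm z (a + a') b = homogeneousForm z a b + homogeneousForm z a' b := by
  simp only [homogeneousForm, stdSymplectic, star_add, add_dotProduct, add_mul, Complex.add_im]
  ring

lemma homogeneousForm_smul_left : homogeneousForm z (c • a) b = c • homogeneousForm z a b := by
  simp only [homogeneousForm, stdSymplectic, star_smul, smul_dotProduct, star_trivial,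
    smul_mul_assoc, Complex.smul_im, smul_eq_mul]
  ring

lemma homogeneousForm_add_right :
    homogeneousForm z a (b + b') = homogeneousForm z a b + homogeneousForm z a b' := by
  simp only [homogeneousForm, stdSymplectic, dotProduct_add, mul_add, Complex.add_im]
  ring

lemma homogeneousForm_smul_right : homogeneousForm z a (c • b) = c • homogeneousForm z a b := by
  simp only [homogeneousForm, stdSymplectic, dotProduct_smul,
    mul_smul_comm, Complex.smul_im, smul_eq_mul]
  ring

lemma insertAt_zero_add (i : Fin (n + 1)) (u v : Fin n → ℂ) :
    insertAt i 0 (u + v) = insertAt i 0 u + insertAt i 0 v := by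
  funext k
  rcases Fin.eq_self_or_eq_succAbove i k with rfl | ⟨j, rfl⟩ <;> simp

lemma insertAt_zero_smul (i : Fin (n + 1)) (u : Fin n → ℂ) :
    insertAt i 0 (c • u) = c • insertAt i 0 u := by
  funext k
  rcases Fin.eq_self_or_eq_succAbove i k with rfl | ⟨j, rfl⟩ <;> simp

end Bilinear

/-- The Fubini-Study form at the point with inhomogeneous coordinates `w` in the `i`-th affine
chart. The section `w ↦ insertAt i 1 w` of `ℂⁿ⁺¹ ∖ {0} → ℂℙⁿ` over this chart has derivative
`u ↦ insertAt i 0 u`, and the form is the pullback of `(i/2) ∂∂̄ log |z|²` by this section, i.e.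
`((1 + |w|²) Im h(u, v) - Im (h(u, w) h(w, v))) / (1 + |w|²)²`. -/
noncomputable def affineForm (i : Fin (n + 1)) (w : Fin n → ℂ) :
    (Fin n → ℂ) →ₗ[ℝ] (Fin n → ℂ) →ₗ[ℝ] ℝ :=
  LinearMap.mk₂ ℝ
    (fun u v => homogeneousForm (insertAt i 1 w) (insertAt i 0 u) (insertAt i 0 v))
    (fun u u' v => by rw [insertAt_zero_add, homogeneousForm_add_left])
    (fun c u v => by rw [insertAt_zero_smul, homogeneousForm_smul_left])
    (fun u v v' => by rw [insertAt_zero_add, homogeneousForm_add_right])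
    (fun c u v => by rw [insertAt_zero_smul, homogeneousForm_smul_right])

/-- The Fubini-Study form on `ℂℙⁿ`, normalized so that it is the reduction of the standard
symplectic form of `ℂⁿ⁺¹` at the unit sphere (see `fubiniStudy_reduction`). A tangent vector
at `p` is given by its coordinates in the preferred chart at `p`. -/
noncomputable def fubiniStudy (n : ℕ) (p : CP n) :
    TangentSpace 𝓘(ℝ, Fin n → ℂ) p →ₗ[ℝ] TangentSpace 𝓘(ℝ, Fin n → ℂ) p →ₗ[ℝ] ℝ :=
  affineForm (chartIndex p) (affineCoord (chartIndex p) p)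

open Classical in
/-- The projection `ℂⁿ⁺¹ ∖ {0} → ℂℙⁿ`, extended by an arbitrary value at `0`. -/
noncomputable def proj (z : Fin (n + 1) → ℂ) : CP n :=
  if hz : z ≠ 0 then Projectivization.mk ℂ z hz else affinePoint 0 0

lemma proj_of_ne_zero {z : Fin (n + 1) → ℂ} (hz : z ≠ 0) :
    proj z = Projectivization.mk ℂ z hz := dif_pos hz

/-- The derivative of the projection at `z`, in the `i`-th affine chart. -/
noncomputable def projDeriv (i : Fin (n + 1)) (z : Fin (n + 1) → ℂ) :
    (Fin (n + 1) → ℂ) →L[ℝ] (Fin n → ℂ) :=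
  ContinuousLinearMap.pi fun j =>
    (z i)⁻¹ • (ContinuousLinearMap.proj (R := ℝ) (φ := fun _ => ℂ) (i.succAbove j)) -
      (z (i.succAbove j) * ((z i) ^ 2)⁻¹) •
        (ContinuousLinearMap.proj (R := ℝ) (φ := fun _ => ℂ) i)

lemma hasFDerivAt_affineCoord_proj (i : Fin (n + 1)) {z : Fin (n + 1) → ℂ} (hz : z ≠ 0)
    (hzi : z i ≠ 0) : HasFDerivAt (affineCoord i ∘ proj) (projDeriv i z) z := by
  have heq : (affineCoord i ∘ proj) =ᶠ[𝓝 z] fun y j => y (i.succAbove j) * (y i)⁻¹ := by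
    filter_upwards [isOpen_ne.mem_nhds hz] with y hy
    funext j
    simp only [Function.comp_apply, proj_of_ne_zero hy, affineCoord_mk, div_eq_mul_inv]
  refine HasFDerivAt.congr_of_eventuallyEq ?_ heq
  rw [hasFDerivAt_pi']
  intro j
  have h1 := hasFDerivAt_apply (𝕜 := ℝ) (F' := fun _ : Fin (n + 1) => ℂ) (i.succAbove j) z
  have h2 := hasFDerivAt_apply (𝕜 := ℝ) (F' := fun _ : Fin (n + 1) => ℂ) i z
  have h3 := (hasFDerivAt_inv' (𝕜 := ℝ) hzi).comp z h2
  refine (h1.mul h3).congr_fderiv ?_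
  ext v
  simp [projDeriv]
  ring

lemma hasMFDerivAt_proj {z : Fin (n + 1) → ℂ} (hz : z ≠ 0) :
    HasMFDerivAt 𝓘(ℝ, Fin (n + 1) → ℂ) 𝓘(ℝ, Fin n → ℂ) proj z
      (projDeriv (chartIndex (proj z)) z) := by
  have hzi : z (chartIndex (proj z)) ≠ 0 := by
    have := rep_chartIndex_ne_zero (proj z)
    generalize chartIndex (proj z) = i at this ⊢
    rw [proj_of_ne_zero hz] at this
    exact (rep_mk_ne_zero_iff _ _ _).1 this
  constructor
  · have h : ContinuousOn (proj (n := n)) {z | z ≠ 0} := by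
      rw [continuousOn_iff_continuous_domRestrict]
      have : Set.domRestrict {z | z ≠ 0} (proj (n := n)) = pt := by
        funext y
        exact proj_of_ne_zero y.2
      rw [this]
      exact isQuotientMap_pt.continuous
    exact h.continuousAt (isOpen_ne.mem_nhds hz)
  · exact (hasFDerivAt_affineCoord_proj _ hz hzi).hasFDerivWithinAt

lemma star_dotProduct_self_im {m : ℕ} (z : Fin m → ℂ) : (star z ⬝ᵥ z).im = 0 := by
  simp only [dotProduct, Complex.im_sum]
  exact Finset.sum_eq_zero fun k _ => by simp; ring

lemma homogeneousForm_basic {m : ℕ} (z a b : Fin m → ℂ) (c s t : ℂ) (hc : c ≠ 0) :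
    homogeneousForm (c • z) (c • a + s • z) (c • b + t • z) = homogeneousForm z a b := by
  have hnum : ∀ z a b : Fin m → ℂ,
      (star z ⬝ᵥ z).re * stdSymplectic a b - ((star a ⬝ᵥ z) * (star z ⬝ᵥ b)).im =
        ((star z ⬝ᵥ z) * (star a ⬝ᵥ b) - (star a ⬝ᵥ z) * (star z ⬝ᵥ b)).im := fun z a b => by
    rw [Complex.sub_im, Complex.mul_im (star z ⬝ᵥ z), star_dotProduct_self_im, stdSymplectic]
    ring
  have hcc : star c * c = ((Complex.normSq c : ℝ) : ℂ) := by
    rw [mul_comm]; exact Complex.mul_conj c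
  have hden : (star (c • z) ⬝ᵥ (c • z)).re = Complex.normSq c * (star z ⬝ᵥ z).re := by
    rw [star_smul, smul_dotProduct, dotProduct_smul, smul_smul, hcc, smul_eq_mul,
      Complex.re_ofReal_mul]
  have hn : Complex.normSq c ≠ 0 := by simpa using hc
  have hmain : (star (c • z) ⬝ᵥ (c • z)) * (star (c • a + s • z) ⬝ᵥ (c • b + t • z)) -
      (star (c • a + s • z) ⬝ᵥ (c • z)) * (star (c • z) ⬝ᵥ (c • b + t • z)) =
      ((Complex.normSq c ^ 2 : ℝ) : ℂ) *
        ((star z ⬝ᵥ z) * (star a ⬝ᵥ b) - (star a ⬝ᵥ z) * (star z ⬝ᵥ b)) := by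
    rw [Complex.ofReal_pow, ← hcc]
    simp only [star_add, star_smul, add_dotProduct, dotProduct_add, smul_dotProduct,
      dotProduct_smul, smul_eq_mul]
    ring
  unfold homogeneousForm
  rw [hnum, hnum, hmain, hden, Complex.im_ofReal_mul, mul_pow]
  exact mul_div_mul_left _ _ (pow_ne_zero 2 hn)

/-- The Fubini-Study form pulls back to `(i/2) ∂∂̄ log |z|²` on `ℂⁿ⁺¹ ∖ {0}`; in particular it
does not depend on the choice of charts. -/
theorem fubiniStudy_mfderiv_proj {z : Fin (n + 1) → ℂ} (hz : z ≠ 0) (a b : Fin (n + 1) → ℂ) :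
    fubiniStudy n (proj z) (mfderiv 𝓘(ℝ, Fin (n + 1) → ℂ) 𝓘(ℝ, Fin n → ℂ) proj z a)
      (mfderiv 𝓘(ℝ, Fin (n + 1) → ℂ) 𝓘(ℝ, Fin n → ℂ) proj z b) = homogeneousForm z a b := by
  rw [(hasMFDerivAt_proj hz).mfderiv]
  have hzi : z (chartIndex (proj z)) ≠ 0 := by
    have := rep_chartIndex_ne_zero (proj z)
    generalize chartIndex (proj z) = i at this ⊢
    rw [proj_of_ne_zero hz] at this
    exact (rep_mk_ne_zero_iff _ _ _).1 this
  change affineForm _ (affineCoord _ (proj z)) (projDeriv _ z a) (projDeriv _ z b) = _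
  generalize chartIndex (proj z) = i at hzi ⊢
  rw [proj_of_ne_zero hz, affineCoord_mk]
  have hd : ∀ a : Fin (n + 1) → ℂ, insertAt i 0 (projDeriv i z a) =
      (z i)⁻¹ • a + (-(a i * ((z i) ^ 2)⁻¹)) • z := fun a => by
    funext k
    rcases Fin.eq_self_or_eq_succAbove i k with rfl | ⟨j, rfl⟩
    · simp only [insertAt_same, Pi.add_apply, Pi.smul_apply, smul_eq_mul]
      field_simp
      ring
    · simp only [insertAt_succAbove, Pi.add_apply, Pi.smul_apply, smul_eq_mul]
      simp [projDeriv]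
      ring
  have hp : insertAt i 1 (fun j => z (i.succAbove j) / z i) = (z i)⁻¹ • z := by
    funext k
    rcases Fin.eq_self_or_eq_succAbove i k with rfl | ⟨j, rfl⟩
    · simp [hzi]
    · simp [div_eq_inv_mul]
  change homogeneousForm (insertAt i 1 _) (insertAt i 0 _) (insertAt i 0 _) = _
  rw [hd, hd, hp]
  exact homogeneousForm_basic _ _ _ _ _ _ (inv_ne_zero hzi)

/-- The Fubini-Study form is the reduction of the standard symplectic form: its pullback to the
unit sphere `S²ⁿ⁺¹` is the restriction of the standard symplectic form of `ℂⁿ⁺¹`. -/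
theorem fubiniStudy_reduction {z : Fin (n + 1) → ℂ} (hz : star z ⬝ᵥ z = 1)
    {a b : Fin (n + 1) → ℂ} (ha : (star a ⬝ᵥ z).re = 0) (hb : (star z ⬝ᵥ b).re = 0) :
    fubiniStudy n (proj z) (mfderiv 𝓘(ℝ, Fin (n + 1) → ℂ) 𝓘(ℝ, Fin n → ℂ) proj z a)
      (mfderiv 𝓘(ℝ, Fin (n + 1) → ℂ) 𝓘(ℝ, Fin n → ℂ) proj z b) = stdSymplectic a b := by
  have h0 : z ≠ 0 := by
    rintro rfl
    simp at hz
  rw [fubiniStudy_mfderiv_proj h0, homogeneousForm, Complex.mul_im, ha, hb, hz]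
  simp

end CP

/-! ### Lagrangian submanifolds -/

section Lagrangian

variable {E : Type*} [NormedAddCommGroup E] [NormedSpace ℝ E] [FiniteDimensional ℝ E]
  {M : Type*} [TopologicalSpace M] [ChartedSpace E M]

/-- `L` is a smooth embedded `k`-dimensional submanifold of `M`: around each of its points there
is a smooth chart of `M` in which `L` is a `k`-dimensional linear subspace. -/
def IsEmbeddedSubmanifold (E : Type*) [NormedAddCommGroup E] [NormedSpace ℝ E]
    {M : Type*} [TopologicalSpace M] [ChartedSpace E M] (k : ℕ) (L : Set M) : Prop :=
  ∀ p ∈ L, ∃ φ ∈ IsManifold.maximalAtlas 𝓘(ℝ, E) ∞ M, p ∈ φ.source ∧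
    ∃ F : Submodule ℝ E, Module.finrank ℝ F = k ∧
      ∀ q ∈ φ.source, q ∈ L ↔ φ q ∈ F

/-- The vectors of `T_p M` tangent to `L` at `p`: the velocities at time `0` of smooth curves
in `M` which start at `p` and stay in `L`. For an embedded submanifold `L` this is `T_p L`. -/
def tangentVectors (E : Type*) [NormedAddCommGroup E] [NormedSpace ℝ E]
    {M : Type*} [TopologicalSpace M] [ChartedSpace E M] (L : Set M) (p : M) :
    Set (TangentSpace 𝓘(ℝ, E) p) :=
  {v | ∃ γ : ℝ → M, ContMDiffAt 𝓘(ℝ, ℝ) 𝓘(ℝ, E) ∞ γ 0 ∧ (∀ᶠ t in 𝓝 0, γ t ∈ L) ∧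
    (⟨γ 0, mfderiv 𝓘(ℝ, ℝ) 𝓘(ℝ, E) γ 0 (1 : ℝ)⟩ : TangentBundle 𝓘(ℝ, E) M) = ⟨p, v⟩}

/-- `L` is a Lagrangian submanifold of `M` with respect to the (symplectic) form `Ω`: it is an
embedded submanifold of half the dimension of `M`, and `Ω` vanishes on each of its
tangent spaces. -/
structure IsLagrangianSubmanifold
    (Ω : ∀ p : M, TangentSpace 𝓘(ℝ, E) p →ₗ[ℝ] TangentSpace 𝓘(ℝ, E) p →ₗ[ℝ] ℝ)
    (L : Set M) : Prop where
  submanifold : ∃ k : ℕ, 2 * k = Module.finrank ℝ E ∧ IsEmbeddedSubmanifold E k L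
  isotropic : ∀ p ∈ L, ∀ u ∈ tangentVectors E L p, ∀ v ∈ tangentVectors E L p, Ω p u v = 0

end Lagrangian

/-! ### The set `𝓛₂` -/

open ComplexConjugate in
/-- The vector `(ᾱ² + β̄², √2 (ᾱ β - α β̄), α² + β²)` of `ℂ³`. -/
noncomputable def lagVector (α β : ℂ) : Fin 3 → ℂ :=
  ![conj α ^ 2 + conj β ^ 2, (√2 : ℝ) * (conj α * β - α * conj β), α ^ 2 + β ^ 2]

lemma lagVector_ne_zero {α β : ℂ} (h : ‖α‖ ^ 2 + ‖β‖ ^ 2 = 1) : lagVector α β ≠ 0 := by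
  intro h0
  have h1 : α ^ 2 + β ^ 2 = 0 := by simpa [lagVector] using congrFun h0 2
  have h2 : starRingEnd ℂ α * β - α * starRingEnd ℂ β = 0 := by
    simpa [lagVector] using congrFun h0 1
  rw [← Complex.normSq_eq_norm_sq, ← Complex.normSq_eq_norm_sq] at h
  obtain ⟨a, b⟩ := α
  obtain ⟨c, d⟩ := β
  simp only [Complex.ext_iff, Complex.normSq_apply, pow_two, Complex.add_re, Complex.mul_re,
    Complex.add_im, Complex.mul_im, Complex.sub_re, Complex.sub_im, Complex.conj_re,
    Complex.conj_im, Complex.zero_re, Complex.zero_im] at h h1 h2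
  have key : (a * a + b * b + (c * c + d * d)) ^ 2 =
      (a * a - b * b + (c * c - d * d)) ^ 2 + (a * b + b * a + (c * d + d * c)) ^ 2 +
      (a * d + -b * c - (a * -d + b * c)) ^ 2 := by ring
  rw [h, h1.1, h1.2, h2.2] at key
  norm_num at key

/-- The subset `𝓛₂` of `ℂℙ²`. -/
def lagL2 : Set (CP 2) :=
  {p | ∃ (α β : ℂ) (h : ‖α‖ ^ 2 + ‖β‖ ^ 2 = 1),
    p = Projectivization.mk ℂ (lagVector α β) (lagVector_ne_zero h)}

/-!
In linear homogeneous coordinates `𝓛₂` is the real projective plane. The components of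
`(ᾱ² + β̄², √2 (ᾱ β - α β̄), α² + β²)` are, up to `√2` times a unitary matrix, the three real
components of the Hopf map `S³ → S²`, and the Hopf map is onto, so that `𝓛₂` is the image of
`ℝℙ²` under a unitary automorphism of `ℂℙ²`.

More generally, let `e` be a linear automorphism of `ℂⁿ⁺¹` such that the hermitian product is real
on the real subspace `e(ℝⁿ⁺¹)`. In the affine charts of the coordinates given by `e` the image of
`e(ℝⁿ⁺¹)` in `ℂℙⁿ` is `ℝⁿ ⊂ ℂⁿ`, and the Fubini–Study form is the imaginary part of an expression
in hermitian products of vectors of `e(ℝⁿ⁺¹)`, so that it vanishes there.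
-/

section Charts

variable {E : Type*} [NormedAddCommGroup E] [NormedSpace ℝ E]
  {M : Type*} [TopologicalSpace M] [ChartedSpace E M]

lemma mem_of_hasDerivAt_of_eventually_mem {F : Submodule ℝ E} (hF : IsClosed (F : Set E))
    {c : ℝ → E} {c' : E} {t : ℝ} (hc : HasDerivAt c c' t) (hcF : ∀ᶠ s in 𝓝 t, c s ∈ F) :
    c' ∈ F := by
  refine hF.mem_of_tendsto hc.tendsto_slope ?_
  filter_upwards [hcF.filter_mono nhdsWithin_le_nhds] with s hs
  exact F.smul_mem _ (F.sub_mem hs hcF.self_of_nhds)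

variable {L : Set M} {φ : OpenPartialHomeomorph M E} {F : Submodule ℝ E}

lemma mfderiv_mem_of_mem_tangentVectors (hφ : φ ∈ IsManifold.maximalAtlas 𝓘(ℝ, E) ∞ M)
    (hF : IsClosed (F : Set E)) (hL : ∀ q ∈ φ.source, q ∈ L → φ q ∈ F) {p : M}
    (hp : p ∈ φ.source) {v : TangentSpace 𝓘(ℝ, E) p} (hv : v ∈ tangentVectors E L p) :
    (mfderiv 𝓘(ℝ, E) 𝓘(ℝ, E) φ p v : E) ∈ F := by
  obtain ⟨γ, hγ, hγL, hγv⟩ := hv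
  obtain rfl : γ 0 = p := congrArg Bundle.TotalSpace.proj hγv
  obtain rfl := Bundle.TotalSpace.mk_injective _ hγv
  have hφ' : MDifferentiableAt 𝓘(ℝ, E) 𝓘(ℝ, E) φ (γ 0) :=
    (contMDiffAt_of_mem_maximalAtlas hφ hp).mdifferentiableAt (by simp)
  have hγ' : MDifferentiableAt 𝓘(ℝ, ℝ) 𝓘(ℝ, E) γ 0 := hγ.mdifferentiableAt (by simp)
  have hderiv : deriv (φ ∘ γ) 0 =
      mfderiv 𝓘(ℝ, E) 𝓘(ℝ, E) φ (γ 0) (mfderiv 𝓘(ℝ, ℝ) 𝓘(ℝ, E) γ 0 (1 : ℝ)) := by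
    rw [← fderiv_apply_one_eq_deriv, ← mfderiv_eq_fderiv]
    exact mfderiv_comp_apply (0 : ℝ) hφ' hγ' 1
  rw [← hderiv]
  refine mem_of_hasDerivAt_of_eventually_mem hF
    (hφ'.comp (0 : ℝ) hγ').differentiableAt.hasDerivAt ?_
  filter_upwards [hγL, hγ.continuousAt.eventually_mem (φ.open_source.mem_nhds hp)] with t hL' hs
  exact hL _ hs hL'

lemma exists_mfderiv_symm_eq_of_mem_tangentVectors
    (hφ : φ ∈ IsManifold.maximalAtlas 𝓘(ℝ, E) ∞ M) (hF : IsClosed (F : Set E))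
    (hL : ∀ q ∈ φ.source, q ∈ L → φ q ∈ F) {w : E} (hw : w ∈ φ.target)
    {v : TangentSpace 𝓘(ℝ, E) (φ.symm w)} (hv : v ∈ tangentVectors E L (φ.symm w)) :
    ∃ a ∈ F, mfderiv 𝓘(ℝ, E) 𝓘(ℝ, E) φ.symm w a = v := by
  have hp : φ.symm w ∈ φ.source := φ.map_target hw
  refine ⟨_, mfderiv_mem_of_mem_tangentVectors hφ hF hL hp hv, ?_⟩
  have hφ' : MDifferentiableAt 𝓘(ℝ, E) 𝓘(ℝ, E) φ (φ.symm w) :=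
    (contMDiffAt_of_mem_maximalAtlas hφ hp).mdifferentiableAt (by simp)
  have hφ_symm : MDifferentiableAt 𝓘(ℝ, E) 𝓘(ℝ, E) φ.symm w :=
    (contMDiffAt_symm_of_mem_maximalAtlas hφ hw).mdifferentiableAt (by simp)
  have hid : φ.symm ∘ φ =ᶠ[𝓝 (φ.symm w)] id := by
    filter_upwards [φ.open_source.mem_nhds hp] with q hq using φ.left_inv hq
  have hcomp := mfderiv_comp_apply_of_eq _ hφ_symm hφ' (φ.right_inv hw) v
  rw [hid.mfderiv_eq, mfderiv_id] at hcomp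
  exact hcomp.symm

theorem IsLagrangianSubmanifold.of_charts [FiniteDimensional ℝ E]
    {Ω : ∀ p : M, TangentSpace 𝓘(ℝ, E) p →ₗ[ℝ] TangentSpace 𝓘(ℝ, E) p →ₗ[ℝ] ℝ} {k : ℕ}
    (hk : 2 * k = Module.finrank ℝ E)
    (h : ∀ p ∈ L, ∃ φ ∈ IsManifold.maximalAtlas 𝓘(ℝ, E) ∞ M, p ∈ φ.source ∧
      ∃ F : Submodule ℝ E, Module.finrank ℝ F = k ∧ (∀ q ∈ φ.source, q ∈ L ↔ φ q ∈ F) ∧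
        ∀ w ∈ φ.target, w ∈ F → ∀ a ∈ F, ∀ b ∈ F,
          Ω (φ.symm w) (mfderiv 𝓘(ℝ, E) 𝓘(ℝ, E) φ.symm w a)
            (mfderiv 𝓘(ℝ, E) 𝓘(ℝ, E) φ.symm w b) = 0) :
    IsLagrangianSubmanifold Ω L where
  submanifold := by
    refine ⟨k, hk, fun p hp => ?_⟩
    obtain ⟨φ, hφ, hpφ, F, hFk, hFL, -⟩ := h p hp
    exact ⟨φ, hφ, hpφ, F, hFk, hFL⟩
  isotropic p hp u hu v hv := by
    obtain ⟨φ, hφ, hpφ, F, -, hFL, hΩ⟩ := h p hp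
    have hwF : φ p ∈ F := (hFL p hpφ).1 hp
    have hw : φ p ∈ φ.target := φ.map_source hpφ
    obtain ⟨w, hpw⟩ : ∃ w, w = φ p := ⟨_, rfl⟩
    obtain rfl : φ.symm w = p := by rw [hpw, φ.left_inv hpφ]
    rw [← hpw] at hwF hw
    have hF : IsClosed (F : Set E) := F.closed_of_finiteDimensional
    have hL : ∀ q ∈ φ.source, q ∈ L → φ q ∈ F := fun q hq => (hFL q hq).1
    obtain ⟨a, ha, rfl⟩ := exists_mfderiv_symm_eq_of_mem_tangentVectors hφ hF hL hw hu
    obtain ⟨b, hb, rfl⟩ := exists_mfderiv_symm_eq_of_mem_tangentVectors hφ hF hL hw hv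
    exact hΩ w hw hwF a ha b hb

end Charts

section RealVectors

/-- The real subspace `ℝ^ι` of `ℂ^ι`. -/
noncomputable def realVectors (ι : Type*) : Submodule ℝ (ι → ℂ) :=
  LinearMap.range (Complex.ofRealCLM.toLinearMap.compLeft ι)

variable {ι : Type*}

lemma mem_realVectors_iff_exists {x : ι → ℂ} :
    x ∈ realVectors ι ↔ ∃ y : ι → ℝ, x = fun j => (y j : ℂ) :=
  exists_congr fun _ => eq_comm

lemma mem_realVectors_iff_im {x : ι → ℂ} : x ∈ realVectors ι ↔ ∀ j, (x j).im = 0 := by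
  rw [mem_realVectors_iff_exists]
  constructor
  · rintro ⟨y, rfl⟩ j
    exact Complex.ofReal_im _
  · exact fun h => ⟨fun j => (x j).re, funext fun j => Complex.ext rfl (h j)⟩

lemma finrank_realVectors [Fintype ι] : Module.finrank ℝ (realVectors ι) = Fintype.card ι := by
  rw [realVectors, LinearMap.finrank_range_of_inj, Module.finrank_fintype_fun_eq_card]
  exact Complex.ofReal_injective.comp_left

lemma im_star_dotProduct_of_mem_realVectors [Fintype ι] {x y : ι → ℂ} (hx : x ∈ realVectors ι)
    (hy : y ∈ realVectors ι) : (star x ⬝ᵥ y).im = 0 := by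
  rw [mem_realVectors_iff_im] at hx hy
  simp [dotProduct, Complex.im_sum, hx, hy]

end RealVectors

namespace CP

variable {n : ℕ}

lemma proj_mem_affineChart_source {z : Fin (n + 1) → ℂ} (hz : z ≠ 0) (i : Fin (n + 1)) :
    proj z ∈ (affineChart i).source ↔ z i ≠ 0 := by
  rw [proj_of_ne_zero hz]
  exact rep_mk_ne_zero_iff z hz i

lemma affineCoord_proj {z : Fin (n + 1) → ℂ} (hz : z ≠ 0) (i : Fin (n + 1)) :
    affineCoord i (proj z) = fun j => z (i.succAbove j) / z i := by
  rw [proj_of_ne_zero hz, affineCoord_mk]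

lemma affinePoint_eq_proj (i : Fin (n + 1)) (w : Fin n → ℂ) :
    affinePoint i w = proj (insertAt i 1 w) :=
  (proj_of_ne_zero (insertAt_one_ne_zero i w)).symm

lemma proj_smul {c : ℂ} (hc : c ≠ 0) {z : Fin (n + 1) → ℂ} (hz : z ≠ 0) :
    proj (c • z) = proj z := by
  rw [proj_of_ne_zero hz, proj_of_ne_zero (smul_ne_zero hc hz)]
  exact (Projectivization.mk_eq_mk_iff' ℂ _ _ _ _).2 ⟨c, rfl⟩

lemma affineChart_mem_maximalAtlas (i : Fin (n + 1)) :
    affineChart i ∈ IsManifold.maximalAtlas 𝓘(ℝ, Fin n → ℂ) ∞ (CP n) :=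
  IsManifold.subset_maximalAtlas (mem_range_self i)

lemma contMDiffAt_proj {z : Fin (n + 1) → ℂ} (hz : z ≠ 0) :
    ContMDiffAt 𝓘(ℝ, Fin (n + 1) → ℂ) 𝓘(ℝ, Fin n → ℂ) ∞ proj z := by
  rw [contMDiffAt_iff_target]
  refine ⟨(hasMFDerivAt_proj hz).continuousAt, ContDiffAt.contMDiffAt ?_⟩
  change ContDiffAt ℝ ∞ (affineCoord (chartIndex (proj z)) ∘ proj) z
  have hzi : z (chartIndex (proj z)) ≠ 0 :=
    (proj_mem_affineChart_source hz _).1 (rep_chartIndex_ne_zero (proj z))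
  generalize chartIndex (proj z) = i at hzi ⊢
  have hquot : ContDiffAt ℝ ∞ (fun y : Fin (n + 1) → ℂ => fun j => y (i.succAbove j) / y i) z := by
    refine contDiffAt_pi.2 fun j => ?_
    simp only [div_eq_mul_inv]
    exact (contDiff_apply ℝ ℂ _).contDiffAt.mul ((contDiff_apply ℝ ℂ i).contDiffAt.inv hzi)
  refine hquot.congr_of_eventuallyEq ?_
  filter_upwards [isOpen_ne.mem_nhds hz] with y hy using affineCoord_proj hy i

/-- The inclusion `w ↦ insertAt i 0 w` of `ℂⁿ` in `ℂⁿ⁺¹`, the derivative of each of the affine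
embeddings `insertAt i c`. -/
noncomputable def insertZeroCLM (i : Fin (n + 1)) : (Fin n → ℂ) →L[ℝ] (Fin (n + 1) → ℂ) :=
  LinearMap.toContinuousLinearMap
    { toFun := insertAt i 0
      map_add' := insertAt_zero_add i
      map_smul' := fun c => insertAt_zero_smul c i }

lemma hasFDerivAt_insertAt (i : Fin (n + 1)) (c : ℂ) (w : Fin n → ℂ) :
    HasFDerivAt (insertAt i c) (insertZeroCLM i) w := by
  have htranslate : insertAt (n := n) i c = fun u => insertAt i c 0 + insertZeroCLM i u := by
    funext u k
    rcases Fin.eq_self_or_eq_succAbove i k with rfl | ⟨j, rfl⟩ <;> simp [insertZeroCLM]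
  rw [htranslate]
  exact (insertZeroCLM i).hasFDerivAt.const_add _

section LinearAction

variable (e : (Fin (n + 1) → ℂ) ≃ₗ[ℂ] (Fin (n + 1) → ℂ)) (i : Fin (n + 1))

lemma smul_proj {z : Fin (n + 1) → ℂ} (hz : z ≠ 0) : e • proj z = proj (e z) := by
  rw [proj_of_ne_zero hz, proj_of_ne_zero (e.map_ne_zero_iff.2 hz)]
  rfl

lemma contMDiff_smul :
    ContMDiff 𝓘(ℝ, Fin n → ℂ) 𝓘(ℝ, Fin n → ℂ) ∞ (fun p : CP n => e • p) := by
  intro p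
  set i := chartIndex p
  have hp : p ∈ (affineChart i).source := rep_chartIndex_ne_zero p
  have hcoord : ContMDiffAt 𝓘(ℝ, Fin n → ℂ) 𝓘(ℝ, Fin n → ℂ) ∞ (affineCoord i) p :=
    contMDiffAt_of_mem_maximalAtlas (affineChart_mem_maximalAtlas i) hp
  have hlift : ContMDiff 𝓘(ℝ, Fin n → ℂ) 𝓘(ℝ, Fin (n + 1) → ℂ) ∞ fun w => e (insertAt i 1 w) :=
    ((e.toLinearMap.toContinuousLinearMap.restrictScalars ℝ).contDiff.comp
      (contDiff_insertAt i 1)).contMDiff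
  have hne : ∀ w, e (insertAt i 1 w) ≠ 0 := fun w =>
    e.map_ne_zero_iff.2 (insertAt_one_ne_zero i w)
  refine ((contMDiffAt_proj (hne _)).comp p (hlift.contMDiffAt.comp p hcoord)).congr_of_eventuallyEq
    ?_
  filter_upwards [(affineChart i).open_source.mem_nhds hp] with q hq
  have hq' : affinePoint i (affineCoord i q) = q := (affineChart i).left_inv hq
  rw [Function.comp_apply, Function.comp_apply, ← smul_proj e (insertAt_one_ne_zero i _),
    ← affinePoint_eq_proj, hq']

instance : ContinuousConstSMul ((Fin (n + 1) → ℂ) ≃ₗ[ℂ] (Fin (n + 1) → ℂ)) (CP n) where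
  continuous_const_smul e := (contMDiff_smul e).continuous

/-- The `i`-th affine chart of `ℂℙⁿ` in the linear coordinates given by `e`: it sends `e • p` to
the `i`-th inhomogeneous coordinates of `p`. -/
noncomputable def linearChart : OpenPartialHomeomorph (CP n) (Fin n → ℂ) :=
  (Homeomorph.smul e).symm.transOpenPartialHomeomorph (affineChart i)

lemma linearChart_mem_maximalAtlas :
    linearChart e i ∈ IsManifold.maximalAtlas 𝓘(ℝ, Fin n → ℂ) ∞ (CP n) := by
  have hi := affineChart_mem_maximalAtlas i
  rw [IsManifold.mem_maximalAtlas_iff_contMDiffOn]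
  constructor
  · exact (contMDiffOn_of_mem_maximalAtlas hi).comp (contMDiff_smul e⁻¹).contMDiffOn
      fun q hq => hq
  · exact (contMDiff_smul e).comp_contMDiffOn (contMDiffOn_symm_of_mem_maximalAtlas hi)

lemma proj_mem_linearChart_source {z : Fin (n + 1) → ℂ} (hz : z ≠ 0) :
    proj (e z) ∈ (linearChart e i).source ↔ z i ≠ 0 := by
  change e⁻¹ • proj (e z) ∈ (affineChart i).source ↔ z i ≠ 0
  rw [← smul_proj e hz, inv_smul_smul, proj_mem_affineChart_source hz]

lemma linearChart_proj {z : Fin (n + 1) → ℂ} (hz : z ≠ 0) :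
    linearChart e i (proj (e z)) = fun j => z (i.succAbove j) / z i := by
  change affineCoord i (e⁻¹ • proj (e z)) = _
  rw [← smul_proj e hz, inv_smul_smul, affineCoord_proj hz]

lemma linearChart_symm_apply (w : Fin n → ℂ) :
    (linearChart e i).symm w = proj (e (insertAt i 1 w)) := by
  change e • affinePoint i w = _
  rw [affinePoint_eq_proj, smul_proj e (insertAt_one_ne_zero i w)]

lemma fubiniStudy_mfderiv_linearChart_symm (w a b : Fin n → ℂ) :
    fubiniStudy n ((linearChart e i).symm w)
      (mfderiv 𝓘(ℝ, Fin n → ℂ) 𝓘(ℝ, Fin n → ℂ) (linearChart e i).symm w a)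
      (mfderiv 𝓘(ℝ, Fin n → ℂ) 𝓘(ℝ, Fin n → ℂ) (linearChart e i).symm w b) =
    homogeneousForm (e (insertAt i 1 w)) (e (insertAt i 0 a)) (e (insertAt i 0 b)) := by
  let T : (Fin (n + 1) → ℂ) →L[ℝ] (Fin (n + 1) → ℂ) :=
    e.toLinearMap.toContinuousLinearMap.restrictScalars ℝ
  have hne : e (insertAt i 1 w) ≠ 0 := e.map_ne_zero_iff.2 (insertAt_one_ne_zero i w)
  have hsymm : (linearChart e i).symm = proj ∘ (T ∘ insertAt i 1) :=
    funext (linearChart_symm_apply e i)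
  have hlift : HasMFDerivAt 𝓘(ℝ, Fin n → ℂ) 𝓘(ℝ, Fin (n + 1) → ℂ) (T ∘ insertAt i 1) w
      (T ∘L insertZeroCLM i) :=
    (T.hasFDerivAt.comp w (hasFDerivAt_insertAt i 1 w)).hasMFDerivAt
  have hderiv : ∀ u, mfderiv 𝓘(ℝ, Fin n → ℂ) 𝓘(ℝ, Fin n → ℂ) (proj ∘ (T ∘ insertAt i 1)) w u =
      mfderiv 𝓘(ℝ, Fin (n + 1) → ℂ) 𝓘(ℝ, Fin n → ℂ) proj (e (insertAt i 1 w))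
        (e (insertAt i 0 u)) := fun u => by
    rw [mfderiv_comp_apply w (hasMFDerivAt_proj hne).mdifferentiableAt hlift.mdifferentiableAt,
      hlift.mfderiv]
    rfl
  rw [hsymm]
  exact (congrArg₂ (fun u v => fubiniStudy n (proj (e (insertAt i 1 w))) u v)
    (hderiv a) (hderiv b)).trans (fubiniStudy_mfderiv_proj hne _ _)

end LinearAction

section RealProjective

variable (e : (Fin (n + 1) → ℂ) ≃ₗ[ℂ] (Fin (n + 1) → ℂ))

/-- The image in `ℂℙⁿ` of the totally real subspace `e(ℝⁿ⁺¹)` of `ℂⁿ⁺¹`, a copy of `ℝℙⁿ`. -/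
def realProjective : Set (CP n) :=
  {p | ∃ x ∈ realVectors (Fin (n + 1)), x ≠ 0 ∧ p = proj (e x)}

lemma insertAt_mem_realVectors (i : Fin (n + 1)) {c : ℂ} (hc : c.im = 0) {w : Fin n → ℂ}
    (hw : w ∈ realVectors (Fin n)) : insertAt i c w ∈ realVectors (Fin (n + 1)) := by
  rw [mem_realVectors_iff_im] at hw ⊢
  intro k
  rcases Fin.eq_self_or_eq_succAbove i k with rfl | ⟨j, rfl⟩
  · simpa using hc
  · simpa using hw j

lemma mem_realProjective_iff (i : Fin (n + 1)) {q : CP n} (hq : q ∈ (linearChart e i).source) :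
    q ∈ realProjective e ↔ linearChart e i q ∈ realVectors (Fin n) := by
  constructor
  · rintro ⟨x, hx, hx0, rfl⟩
    rw [mem_realVectors_iff_im] at hx ⊢
    intro j
    simp [linearChart_proj e i hx0, Complex.div_im, hx]
  · intro h
    refine ⟨insertAt i 1 (linearChart e i q), insertAt_mem_realVectors i Complex.one_im h,
      insertAt_one_ne_zero _ _, ?_⟩
    rw [← linearChart_symm_apply, (linearChart e i).left_inv hq]

lemma homogeneousForm_eq_zero_of_im_eq_zero {m : ℕ} {z a b : Fin m → ℂ}
    (hab : (star a ⬝ᵥ b).im = 0) (haz : (star a ⬝ᵥ z).im = 0) (hzb : (star z ⬝ᵥ b).im = 0) :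
    homogeneousForm z a b = 0 := by
  simp [homogeneousForm, stdSymplectic, Complex.mul_im, hab, haz, hzb]

variable {e} in
theorem isLagrangianSubmanifold_realProjective
    (he : ∀ x ∈ realVectors (Fin (n + 1)), ∀ y ∈ realVectors (Fin (n + 1)),
      (star (e x) ⬝ᵥ e y).im = 0) :
    IsLagrangianSubmanifold (fubiniStudy n) (realProjective e) := by
  have hdim : 2 * n = Module.finrank ℝ (Fin n → ℂ) := by
    simp [Module.finrank_pi_fintype, Complex.finrank_real_complex, mul_comm]
  refine .of_charts hdim ?_
  rintro _ ⟨x, -, hx0, rfl⟩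
  obtain ⟨i, hi⟩ : ∃ i, x i ≠ 0 := Function.ne_iff.1 hx0
  refine ⟨linearChart e i, linearChart_mem_maximalAtlas e i,
    (proj_mem_linearChart_source e i hx0).2 hi, realVectors (Fin n), by simp [finrank_realVectors],
    fun q => mem_realProjective_iff e i, fun w _ hw a ha b hb => ?_⟩
  have hz := insertAt_mem_realVectors i Complex.one_im hw
  have ha := insertAt_mem_realVectors i Complex.zero_im ha
  have hb := insertAt_mem_realVectors i Complex.zero_im hb
  rw [fubiniStudy_mfderiv_linearChart_symm]
  exact homogeneousForm_eq_zero_of_im_eq_zero (he _ ha _ hb) (he _ ha _ hz) (he _ hz _ hb)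

end RealProjective

end CP

section HopfMap

open ComplexConjugate

/-- The Hopf map `(α, β) ↦ (Re (α² + β²), Im (α² + β²), 2 Im (ᾱ β))` from the unit sphere of `ℂ²`
to the unit sphere of `ℝ³`. In the coordinates `ξ = α + i β`, `η = α - i β` it takes the familiar
form `(ξ η, (|η|² - |ξ|²) / 2)`. -/
noncomputable def hopfMap (α β : ℂ) : Fin 3 → ℝ :=
  ![(α ^ 2 + β ^ 2).re, (α ^ 2 + β ^ 2).im, 2 * (conj α * β).im]

lemma exists_mul_eq_and_norm_sq_eq {w : ℂ} {r s : ℝ} (hr : 0 ≤ r) (hs : 0 ≤ s)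
    (h : ‖w‖ ^ 2 = r * s) : ∃ ξ η : ℂ, ξ * η = w ∧ ‖ξ‖ ^ 2 = r ∧ ‖η‖ ^ 2 = s := by
  refine ⟨(√r : ℝ), (√s : ℝ) * Complex.exp (w.arg * Complex.I), ?_, ?_, ?_⟩
  · rw [← mul_assoc, ← Complex.ofReal_mul, ← Real.sqrt_mul hr, ← h, Real.sqrt_sq (norm_nonneg w),
      Complex.norm_mul_exp_arg_mul_I]
  · simp [hr]
  · simp [Complex.norm_exp_ofReal_mul_I, hs]

lemma exists_hopfMap_eq {x : Fin 3 → ℝ} (hx : x ⬝ᵥ x = 1) :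
    ∃ α β : ℂ, ‖α‖ ^ 2 + ‖β‖ ^ 2 = 1 ∧ hopfMap α β = x := by
  simp only [dotProduct, Fin.sum_univ_three] at hx
  obtain ⟨ξ, η, hw, hξ, hη⟩ : ∃ ξ η : ℂ, ξ * η = ⟨x 0, x 1⟩ ∧ ‖ξ‖ ^ 2 = 1 - x 2 ∧
      ‖η‖ ^ 2 = 1 + x 2 := by
    refine exists_mul_eq_and_norm_sq_eq (by nlinarith) (by nlinarith) ?_
    rw [← Complex.normSq_eq_norm_sq, Complex.normSq_mk]
    linarith
  have hsq : ((ξ + η) / 2) ^ 2 + (Complex.I * (η - ξ) / 2) ^ 2 = ξ * η := by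
    linear_combination ((η - ξ) ^ 2 / 4) * Complex.I_sq
  refine ⟨(ξ + η) / 2, Complex.I * (η - ξ) / 2, ?_, ?_⟩
  · rw [norm_div, norm_div, norm_mul, Complex.norm_I, one_mul, Complex.norm_two, norm_sub_rev]
    linarith [parallelogram_law_with_norm ℝ ξ η]
  · have him : 2 * (conj ((ξ + η) / 2) * (Complex.I * (η - ξ) / 2)).im = x 2 := by
      rw [← Complex.normSq_eq_norm_sq, Complex.normSq_apply] at hξ hη
      have hconj : conj (2 : ℂ) = 2 := Complex.conj_ofNat 2
      simp only [map_div₀, map_add, hconj, Complex.mul_im, Complex.div_ofNat_re, Complex.add_re,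
        Complex.conj_re, Complex.div_ofNat_im, Complex.I_re, Complex.sub_im, zero_mul, Complex.I_im,
        Complex.sub_re, one_mul, zero_add, Complex.add_im, Complex.conj_im, Complex.mul_re,
        zero_sub, neg_sub]
      linarith
    rw [hopfMap, hsq, hw, him]
    funext k
    fin_cases k <;> rfl

lemma exists_hopfMap_eq_smul {x : Fin 3 → ℝ} (hx : x ≠ 0) :
    ∃ α β : ℂ, ‖α‖ ^ 2 + ‖β‖ ^ 2 = 1 ∧ ∃ r : ℝ, r ≠ 0 ∧ hopfMap α β = r • x := by
  have hpos : 0 < x ⬝ᵥ x := by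
    simpa using Matrix.dotProduct_star_self_pos_iff.2 hx
  have hr : √(x ⬝ᵥ x) ≠ 0 := (Real.sqrt_pos.2 hpos).ne'
  obtain ⟨α, β, hαβ, h⟩ := exists_hopfMap_eq (x := (√(x ⬝ᵥ x))⁻¹ • x) (by
    rw [smul_dotProduct, dotProduct_smul, smul_eq_mul, smul_eq_mul]
    nth_rewrite 3 [← Real.sq_sqrt hpos.le]
    field_simp)
  exact ⟨α, β, hαβ, _, inv_ne_zero hr, h⟩

end HopfMap

section LagrangianFrame

open ComplexConjugate Matrix

/-- The matrix of `(x₀, x₁, x₂) ↦ (x₀ - i x₁, √2 i x₂, x₀ + i x₁)`. It is `√2` times a unitary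
matrix, and it carries the real points of `ℂℙ²` to `𝓛₂`. -/
noncomputable def lagMatrix : Matrix (Fin 3) (Fin 3) ℂ :=
  !![1, -Complex.I, 0; 0, 0, (√2 : ℝ) * Complex.I; 1, Complex.I, 0]

lemma conjTranspose_lagMatrix_mul_self : lagMatrixᴴ * lagMatrix = (2 : ℂ) • 1 := by
  have hsqrt : ((√2 : ℝ) : ℂ) * (√2 : ℝ) = 2 := by
    rw [← Complex.ofReal_mul, Real.mul_self_sqrt zero_le_two, Complex.ofReal_ofNat]
  have hmid : -((√2 : ℝ) * Complex.I * ((√2 : ℝ) * Complex.I)) = 2 := by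
    rw [mul_mul_mul_comm, hsqrt, Complex.I_mul_I, mul_neg_one, neg_neg]
  ext j k
  fin_cases j <;> fin_cases k <;>
    simp [lagMatrix, mul_apply, Fin.sum_univ_three, hmid, one_add_one_eq_two]

lemma inv_two_smul_conjTranspose_lagMatrix_mul_self : ((2 : ℂ)⁻¹ • lagMatrixᴴ) * lagMatrix = 1 := by
  rw [smul_mul, conjTranspose_lagMatrix_mul_self, inv_smul_smul₀ two_ne_zero]

/-- The linear automorphism of `ℂ³` with matrix `lagMatrix`. -/
noncomputable def lagFrame : (Fin 3 → ℂ) ≃ₗ[ℂ] (Fin 3 → ℂ) :=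
  toLin'OfInv inv_two_smul_conjTranspose_lagMatrix_mul_self
    (mul_eq_one_comm.1 inv_two_smul_conjTranspose_lagMatrix_mul_self)

lemma lagFrame_apply (x : Fin 3 → ℂ) : lagFrame x = lagMatrix *ᵥ x := rfl

lemma star_lagFrame_dotProduct_lagFrame (x y : Fin 3 → ℂ) :
    star (lagFrame x) ⬝ᵥ lagFrame y = 2 * (star x ⬝ᵥ y) := by
  rw [lagFrame_apply, lagFrame_apply, star_mulVec, ← dotProduct_mulVec, mulVec_mulVec,
    conjTranspose_lagMatrix_mul_self, smul_mulVec, one_mulVec, dotProduct_smul, smul_eq_mul]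

lemma lagMatrix_mulVec (x : Fin 3 → ℂ) : lagMatrix *ᵥ x =
    ![x 0 - Complex.I * x 1, (√2 : ℝ) * (Complex.I * x 2), x 0 + Complex.I * x 1] := by
  funext k
  fin_cases k <;> simp [lagMatrix, vecHead, vecTail, sub_eq_add_neg, mul_assoc]

lemma lagVector_eq_lagFrame_hopfMap (α β : ℂ) :
    lagVector α β = lagFrame (fun k => (hopfMap α β k : ℂ)) := by
  have hfst : conj α ^ 2 + conj β ^ 2 = (α ^ 2 + β ^ 2).re - Complex.I * (α ^ 2 + β ^ 2).im := by
    rw [← map_pow, ← map_pow, ← map_add]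
    generalize α ^ 2 + β ^ 2 = w
    apply Complex.ext <;> simp
  have hsnd : conj α * β - α * conj β = Complex.I * (2 * (conj α * β).im : ℝ) := by
    rw [mul_comm Complex.I, ← Complex.sub_conj, map_mul, Complex.conj_conj]
  have hthd : α ^ 2 + β ^ 2 = (α ^ 2 + β ^ 2).re + Complex.I * (α ^ 2 + β ^ 2).im := by
    rw [mul_comm, Complex.re_add_im]
  rw [lagFrame_apply, lagMatrix_mulVec, lagVector, hfst, hsnd]
  exact congrArg (fun w => ![_, _, w]) hthd

lemma lagL2_eq_realProjective : lagL2 = CP.realProjective lagFrame := by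
  ext p
  constructor
  · rintro ⟨α, β, h, rfl⟩
    have h0 := lagVector_ne_zero h
    rw [← CP.proj_of_ne_zero h0]
    rw [lagVector_eq_lagFrame_hopfMap] at h0 ⊢
    exact ⟨_, mem_realVectors_iff_exists.2 ⟨_, rfl⟩, lagFrame.map_ne_zero_iff.1 h0, rfl⟩
  · rintro ⟨_, hx, hx0, rfl⟩
    obtain ⟨x, rfl⟩ := mem_realVectors_iff_exists.1 hx
    obtain ⟨α, β, hαβ, r, hr, h⟩ := exists_hopfMap_eq_smul (x := x) (by
      rintro rfl
      exact hx0 (funext fun _ => Complex.ofReal_zero))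
    have hvec : lagVector α β = (r : ℂ) • lagFrame fun k => (x k : ℂ) := by
      rw [lagVector_eq_lagFrame_hopfMap, h, ← map_smul]
      congr 1
      funext k
      simp
    refine ⟨α, β, hαβ, ?_⟩
    rw [← CP.proj_of_ne_zero, hvec,
      CP.proj_smul (Complex.ofReal_ne_zero.2 hr) (lagFrame.map_ne_zero_iff.2 hx0)]

end LagrangianFrame

theorem mainTheorem3 : IsLagrangianSubmanifold (CP.fubiniStudy 2) lagL2 := by
  rw [lagL2_eq_realProjective]
  refine CP.isLagrangianSubmanifold_realProjective fun x hx y hy => ?_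
  simp [star_lagFrame_dotProduct_lagFrame, im_star_dotProduct_of_mem_realVectors hx hy]
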